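/- Setting. A $K$-armed bandit has reward distributions $\nu_1,\dots,\nu_K$ on $\mathbb{R}$ with CDFs $F_i$ and finite means $\mu_i$; $i^*$ is the unique arm of largest mean, $\mu^*=\mu_{i^*}$, and $\Delta_j=\mu^*-\mu_j$. In each round $t=1,2,\dots$ the player pulls an arm $I_t$. The clean reward $\tilde X_{i,t}$ of arm $i$ has distribution $\nu_i$, independently of the past and of the choice of $I_t$. With probability $\rho\in(0,1)$, independently of the past and of the choice of $I_t$, an adversary attacks, and then the player observes $X_t=\tilde X_{I_t,t}+\eta_t$; otherwise the player observes $X_t=\tilde X_{I_t,t}$. The attack values $\eta_t\in\mathbb{R}$ are arbitrary and unbounded and may depend on everything that has happened up to and including round $t$. The pseudo-regret is $\bar R_T=\mu^*T-\mathbb{E}\big[\sum_{t=1}^T\mu_{I_t}\big]$. Algorithm (med-$\epsilon$-greedy with parameter $c$). In the first $\lceil c\rceil K$ rounds every arm is pulled $\lceil c\rceil$ times. In each later round $t$, with probability $cK/t$ an arm chosen uniformly from all $K$ arms is pulled, and otherwise an arm whose observed rewards up to round $t-1$ have the largest sample median is pulled (ties broken in any way). The sample median of $m$ observations is $\inf\{x:\hat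 F(x)\ge 1/2\}$, with $\hat F$ their empirical CDF. Theorem. Suppose there are $0<s<1$ and $x_0\in\mathbb{R}$ with $F_{i^*}(x_0)<\tfrac12-s$ and $F_j(x_0)>\tfrac12+s$ for all $j\ne i^*$. Suppose $\rho<s$ and $$c>\max\Big\{20,\ \frac{2}{(F_j(x_0)-\frac12-s)^2},\ \frac{2}{(\frac12-s-F_{i^*}(x_0))^2},\ \frac{2}{(s-\rho)^2}\ :\ j\neq i^*\Big\}.$$ If all means $\mu_i$ are non-negative, then the pseudo-regret of med-$\epsilon$-greedy satisfies, for every $T\ge 1$, $$\bar R_T\le c\sum_{j\ne i^*}\Delta_j\log T+2cKe\,\mu^*+\sum_{j\neq i^*}(2+3c)\Delta_j .$$ Moreover (whatever the signs of the means), for fixed $\Delta_j$, $K$ and $c$, $\bar R_T=\mathcal{O}(\log T)$: there are $M,\zeta>0$ depending only on $K$, $i^*$, $(\Delta_j)_{j\ne i^*}$ and $c$ such that $\bar R_T\le M\log T$ for all $T\ge\zeta$. -/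

import Mathlib

open MeasureTheory ProbabilityTheory

noncomputable section

namespace MedBandit

/-- Generalized `p`-quantile `θ_p(F) = inf {y : F y ≥ p}` of a distribution function `F`. -/
def quantile (p : ℝ) (F : ℝ → ℝ) : ℝ := sInf {y : ℝ | p ≤ F y}

/-- Empirical distribution function of the finite sample `(x τ)_{τ ∈ S}`. -/
def empiricalCDF (S : Finset ℕ) (x : ℕ → ℝ) (y : ℝ) : ℝ :=
  ((S.filter fun τ => x τ ≤ y).card : ℝ) / (S.card : ℝ)

/-- Sample median: the `1/2`-quantile of the empirical distribution. -/
def sampleMedian (S : Finset ℕ) (x : ℕ → ℝ) : ℝ := quantile (1 / 2) (empiricalCDF S x)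

/-- Mean of a reward distribution. -/
def mean (ν : Measure ℝ) : ℝ := ∫ x, x ∂ν

/-- A run of a `K`-armed bandit with reward distributions `ν i` under attack with probability `ρ`,
on the probability space `(Ω, P)`. The rounds are `1, 2, 3, …`; the values at index `0` of the
processes are not used.

* `hist t` is everything that has happened in the rounds `1, …, t` (all clean rewards, attacks,
  attack values, and any internal randomness of the player or the adversary);
* `pre t` is what is available at the moment the arm of round `t` is pulled: the past together with
  the internal randomness the player uses in round `t`;
* `clean t i` is the unattacked reward of arm `i` in round `t`;
* `attacked t` says whether the adversary attacks in round `t`;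
* `attackValue t` is the attack value of round `t`. It is an arbitrary real random variable that
  does not depend on the future: it may depend on the whole past, on the arm just pulled and even
  on the clean reward of the present round. -/
structure AttackedBandit {K : ℕ} (ν : Fin K → Measure ℝ) (ρ : ℝ)
    {Ω : Type*} [mΩ : MeasurableSpace Ω] (P : Measure Ω) where
  hist : Filtration ℕ mΩ
  pre : ℕ → MeasurableSpace Ω
  arm : ℕ → Ω → Fin K
  clean : ℕ → Fin K → Ω → ℝ
  attacked : ℕ → Ω → Bool
  attackValue : ℕ → Ω → ℝ
  hist_le_pre : ∀ t, hist t ≤ pre (t + 1)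
  pre_le_hist : ∀ t, pre (t + 1) ≤ hist (t + 1)
  arm_measurable : ∀ t, Measurable[pre (t + 1)] (arm (t + 1))
  clean_measurable : ∀ t i, Measurable[hist (t + 1)] (clean (t + 1) i)
  attacked_measurable : ∀ t, Measurable[hist (t + 1)] (attacked (t + 1))
  attackValue_measurable : ∀ t, Measurable[hist (t + 1)] (attackValue (t + 1))
  /-- The clean reward of arm `i` has distribution `ν i`, ... -/
  clean_law : ∀ t i, P.map (clean (t + 1) i) = ν i
  /-- ... independently of the past and of the choice of the arm. -/
  clean_indep : ∀ t i, Indep (MeasurableSpace.comap (clean (t + 1) i) inferInstance)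
    (pre (t + 1)) P
  /-- The adversary attacks with probability `ρ`, ... -/
  attacked_prob : ∀ t, P {ω | attacked (t + 1) ω = true} = ENNReal.ofReal ρ
  /-- ... independently of the past and of the choice of the arm. -/
  attacked_indep : ∀ t, Indep (MeasurableSpace.comap (attacked (t + 1)) inferInstance)
    (pre (t + 1)) P

namespace AttackedBandit

variable {K : ℕ} {ν : Fin K → Measure ℝ} {ρ : ℝ} {Ω : Type*} [mΩ : MeasurableSpace Ω]
  {P : Measure Ω}

/-- The reward the player observes in round `t`: the clean reward of the arm pulled, plus the attack
value if the adversary attacks. -/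
def observed (B : AttackedBandit ν ρ P) (t : ℕ) (ω : Ω) : ℝ :=
  B.clean t (B.arm t ω) ω + if B.attacked t ω = true then B.attackValue t ω else 0

/-- The rounds up to round `t` in which arm `j` is pulled. -/
def pulls (B : AttackedBandit ν ρ P) (j : Fin K) (t : ℕ) (ω : Ω) : Finset ℕ :=
  (Finset.Icc 1 t).filter fun τ => B.arm τ ω = j

/-- Sample median of the rewards observed from arm `j` up to round `t`. -/
def med (B : AttackedBandit ν ρ P) (j : Fin K) (t : ℕ) (ω : Ω) : ℝ :=
  sampleMedian (B.pulls j t ω) fun τ => B.observed τ ω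

/-- Pseudo-regret after `T` rounds, with respect to the arm `iStar`. -/
def pseudoRegret (B : AttackedBandit ν ρ P) (iStar : Fin K) (T : ℕ) : ℝ :=
  mean (ν iStar) * (T : ℝ) - ∫ ω, ∑ t ∈ Finset.Icc 1 T, mean (ν (B.arm t ω)) ∂P

/-- The arms of the run `B` are pulled by med-ε-greedy with exploration parameter `c`: every arm is
pulled `⌈c⌉` times in the first `⌈c⌉ K` rounds (in any order); in every later round `t`, a fresh
coin shows `explore` with probability `c K / t`, in which case an independent uniformly chosen arm
is pulled, and otherwise some arm of maximal sample median is pulled (ties are broken in any way).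
-/
structure IsMedEpsGreedy (B : AttackedBandit ν ρ P) (c : ℝ) : Prop where
  init : ∀ j ω, (B.pulls j (⌈c⌉₊ * K) ω).card = ⌈c⌉₊
  step : ∃ (explore : ℕ → Ω → Bool) (unif : ℕ → Ω → Fin K), ∀ t, ⌈c⌉₊ * K ≤ t →
    Measurable[B.pre (t + 1)] (explore (t + 1)) ∧
    Measurable[B.pre (t + 1)] (unif (t + 1)) ∧
    Indep (MeasurableSpace.comap (fun ω => (explore (t + 1) ω, unif (t + 1) ω)) inferInstance)
      (B.hist t) P ∧
    IndepFun (explore (t + 1)) (unif (t + 1)) P ∧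
    P {ω | explore (t + 1) ω = true} = ENNReal.ofReal (c * (K : ℝ) / ((t : ℝ) + 1)) ∧
    (∀ j, P {ω | unif (t + 1) ω = j} = ENNReal.ofReal (1 / (K : ℝ))) ∧
    (∀ ω, explore (t + 1) ω = true → B.arm (t + 1) ω = unif (t + 1) ω) ∧
    (∀ ω, explore (t + 1) ω = false → ∀ j, B.med j t ω ≤ B.med (B.arm (t + 1) ω) t ω)

end AttackedBandit

end MedBandit

end

open MedBandit

/-! ### Sample medians and integrals of independent factors. -/

namespace MedBandit

/-! Call a pull of arm `j` misleading if it is attacked or if its clean reward lies on the wrong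
side of `x₀`. However large the attack values are, the sample median is on the right side unless at
least half of the pulls mislead. With `δ = s - ρ`, a pull misleads with conditional probability at
most `1/2 - δ`. Hence `weight`, the product of `v⁻¹` over misleading pulls and `v = 1 - 2δ` over the
others, shrinks in conditional mean by a factor at most `1 - 2δ²` at each pull
(`integral_weight_succ_add_le`), and it is at least `1` whenever the median is wrong
(`one_le_weight`). So it dominates the indicator of a wrong median.

If a suboptimal arm is pulled outside exploration, its own weight or that of `iStar` is at least `1`
(`regret_step_le`). The first case is charged to the pull itself, which lowers that weight; these
charges telescope to at most `1/(2δ²) ≤ c/4` per arm. In the second case `iStar` is not pulled, and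
only exploration drives its weight down (`integral_weight_succ_le`): since `cδ² ≥ 2`, its mean `a t`
satisfies `(t+1) a (t+1) ≤ (t-1) a t`, so `∑ a t` telescopes against `t * a t` and is at most the
length of the initial phase. Exploration itself costs `c log T` per arm. -/

/-- The real `sInf` is meaningful only on sets bounded below; here the empirical CDF vanishes below
the sample. -/
lemma mem_lowerBounds_half_le_empiricalCDF (S : Finset ℕ) (x : ℕ → ℝ) (b : ℝ)
    (hb : ∀ τ ∈ S, b ≤ x τ) : b ∈ lowerBounds {y : ℝ | 1 / 2 ≤ empiricalCDF S x y} := by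
  intro y hy
  by_contra! hlt
  have h0 : S.filter (fun τ => x τ ≤ y) = ∅ :=
    Finset.filter_eq_empty_iff.2 fun τ hτ => not_le.2 (hlt.trans_le (hb τ hτ))
  simp only [Set.mem_ofPred_eq, empiricalCDF, h0] at hy
  norm_num at hy

lemma sampleMedian_le (S : Finset ℕ) (x : ℕ → ℝ) (a : ℝ) (hS : 0 < S.card)
    (h : S.card ≤ 2 * (S.filter fun τ => x τ ≤ a).card) : sampleMedian S x ≤ a := by
  have hne : S.Nonempty := Finset.card_pos.1 hS
  refine csInf_le ⟨S.inf' hne x, mem_lowerBounds_half_le_empiricalCDF S x _ fun τ hτ =>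
    Finset.inf'_le x hτ⟩ ?_
  have hS' : (0 : ℝ) < S.card := by exact_mod_cast hS
  have h' : (S.card : ℝ) ≤ 2 * ((S.filter fun τ => x τ ≤ a).card : ℝ) := by exact_mod_cast h
  simp only [Set.mem_ofPred_eq, empiricalCDF]
  rw [div_le_div_iff₀ (by norm_num) hS']
  linarith

lemma lt_sampleMedian (S : Finset ℕ) (x : ℕ → ℝ) (a : ℝ)
    (h : 2 * (S.filter fun τ => x τ ≤ a).card < S.card) : a < sampleMedian S x := by
  have hS : 0 < S.card := by omega
  have hS' : (0 : ℝ) < S.card := by exact_mod_cast hS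
  have hne : (S.filter fun τ => a < x τ).Nonempty := by
    rw [Finset.nonempty_iff_ne_empty]
    intro h0
    rw [Finset.filter_eq_empty_iff] at h0
    have : S.filter (fun τ => x τ ≤ a) = S :=
      Finset.filter_true_of_mem fun τ hτ => not_lt.1 (h0 hτ)
    rw [this] at h
    omega
  -- The empirical CDF is constant on `[a, b)`, so the median is at least `b`; this is what makes
  -- the inequality strict.
  set b := (S.filter fun τ => a < x τ).inf' hne x with hb
  have hab : a < b := by
    rw [hb, Finset.lt_inf'_iff]
    exact fun τ hτ => (Finset.mem_filter.1 hτ).2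
  refine hab.trans_le (le_csInf ?_ ?_)
  · refine ⟨S.sup' (Finset.card_pos.1 hS) x, ?_⟩
    have hall : S.filter (fun τ => x τ ≤ S.sup' (Finset.card_pos.1 hS) x) = S :=
      Finset.filter_true_of_mem fun τ hτ => Finset.le_sup' x hτ
    simp only [Set.mem_ofPred_eq, empiricalCDF, hall]
    rw [div_self hS'.ne']
    norm_num
  · intro y hy
    by_contra! hlt
    have hsub : S.filter (fun τ => x τ ≤ y) ⊆ S.filter fun τ => x τ ≤ a := by
      intro τ hτ
      rw [Finset.mem_filter] at hτ ⊢
      refine ⟨hτ.1, ?_⟩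
      by_contra! hax
      exact absurd (Finset.inf'_le x (Finset.mem_filter.2 ⟨hτ.1, hax⟩))
        (not_le.2 (hτ.2.trans_lt hlt))
    have hcard := Finset.card_le_card hsub
    simp only [Set.mem_ofPred_eq, empiricalCDF] at hy
    rw [div_le_div_iff₀ (by norm_num) hS'] at hy
    have : S.card ≤ 2 * (S.filter fun τ => x τ ≤ y).card := by
      have : (S.card : ℝ) ≤ 2 * ((S.filter fun τ => x τ ≤ y).card : ℝ) := by linarith
      exact_mod_cast this
    omega

lemma integral_indicator_mul_of_indep {Ω : Type*} {m₁ m₂ mΩ : MeasurableSpace Ω} {P : Measure Ω}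
    (h₁ : m₁ ≤ mΩ) (h₂ : m₂ ≤ mΩ) (hi : Indep m₁ m₂ P) {A : Set Ω}
    (hA : MeasurableSet[m₁] A) {H : Ω → ℝ} (hH : Measurable[m₂] H) :
    ∫ ω, A.indicator (fun _ => (1 : ℝ)) ω * H ω ∂P = P.real A * ∫ ω, H ω ∂P := by
  have hm : Measurable[m₁] (A.indicator fun _ => (1 : ℝ)) :=
    (@measurable_const _ _ _ m₁ (1 : ℝ)).indicator hA
  have hind : IndepFun (A.indicator fun _ => (1 : ℝ)) H P := by
    rw [IndepFun_iff_Indep]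
    exact indep_of_indep_of_le_left (indep_of_indep_of_le_right hi hH.comap_le) hm.comap_le
  rw [hind.integral_fun_mul_eq_mul_integral (hm.mono h₁ le_rfl).aestronglyMeasurable
    (hH.mono h₂ le_rfl).aestronglyMeasurable, integral_indicator (h₁ _ hA)]
  simp

namespace AttackedBandit

/-! ### The exponential weight and its drift. -/

section

variable {K : ℕ} {ν : Fin K → Measure ℝ} {ρ : ℝ} {Ω : Type*} [mΩ : MeasurableSpace Ω]
  {P : Measure Ω}

/-- The reward of arm `j` in round `t` is misleading: it is attacked, or the clean reward lies in
the set `C` of values on the wrong side of the threshold. -/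
def misleading (B : AttackedBandit ν ρ P) (C : Set ℝ) (j : Fin K) (t : ℕ) : Set Ω :=
  {ω | B.attacked t ω = true} ∪ B.clean t j ⁻¹' C

open Classical in
/-- The factor that round `t` contributes to `weight`. -/
noncomputable def factor (B : AttackedBandit ν ρ P) (v : ℝ) (C : Set ℝ) (j : Fin K) (t : ℕ) (ω : Ω) : ℝ :=
  if B.arm t ω = j then (if ω ∈ B.misleading C j t then v⁻¹ else v) else 1

/-- The exponential supermartingale that counts misleading against trustworthy pulls of arm `j`. -/
noncomputable def weight (B : AttackedBandit ν ρ P) (v : ℝ) (C : Set ℝ) (j : Fin K) (t : ℕ) (ω : Ω) : ℝ :=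
  ∏ τ ∈ Finset.Icc 1 t, B.factor v C j τ ω

variable (B : AttackedBandit ν ρ P) {v : ℝ} {C : Set ℝ} (j : Fin K)

lemma factor_nonneg (hv : 0 < v) (t : ℕ) (ω : Ω) : 0 ≤ B.factor v C j t ω := by
  unfold factor
  split_ifs <;> positivity

lemma factor_le (hv : 0 < v) (hv1 : v ≤ 1) (t : ℕ) (ω : Ω) : B.factor v C j t ω ≤ v⁻¹ := by
  have h1 : 1 ≤ v⁻¹ := (one_le_inv₀ hv).2 hv1
  unfold factor
  split_ifs <;> linarith

lemma weight_nonneg (hv : 0 < v) (t : ℕ) (ω : Ω) : 0 ≤ B.weight v C j t ω :=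
  Finset.prod_nonneg fun τ _ => B.factor_nonneg j hv τ ω

lemma weight_le (hv : 0 < v) (hv1 : v ≤ 1) (t : ℕ) (ω : Ω) :
    B.weight v C j t ω ≤ v⁻¹ ^ t := by
  calc B.weight v C j t ω ≤ ∏ _τ ∈ Finset.Icc 1 t, v⁻¹ :=
        Finset.prod_le_prod (fun τ _ => B.factor_nonneg j hv τ ω)
          fun τ _ => B.factor_le j hv hv1 τ ω
    _ = v⁻¹ ^ t := by simp

lemma weight_succ (t : ℕ) (ω : Ω) :
    B.weight v C j (t + 1) ω = B.weight v C j t ω * B.factor v C j (t + 1) ω :=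
  Finset.prod_Icc_succ_top (by omega) _

lemma measurableSet_misleading (hC : MeasurableSet C) (t : ℕ) :
    MeasurableSet[B.hist (t + 1)] (B.misleading C j (t + 1)) :=
  MeasurableSet.union (B.attacked_measurable t (measurableSet_singleton true))
    (B.clean_measurable t j hC)

lemma measurableSet_arm_eq (t : ℕ) :
    MeasurableSet[B.pre (t + 1)] {ω | B.arm (t + 1) ω = j} :=
  B.arm_measurable t (measurableSet_singleton j)

lemma measurable_factor (hC : MeasurableSet C) (t : ℕ) :
    Measurable[B.hist (t + 1)] (B.factor v C j (t + 1)) := by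
  classical
  exact Measurable.ite (B.pre_le_hist t _ (B.measurableSet_arm_eq j t))
    (Measurable.ite (B.measurableSet_misleading j hC t) measurable_const measurable_const)
    measurable_const

lemma measurable_weight (hC : MeasurableSet C) (t : ℕ) :
    Measurable[B.hist t] (B.weight v C j t) := by
  induction t with
  | zero => exact (measurable_const (a := (1 : ℝ)))
  | succ t ih =>
    have : B.weight v C j (t + 1) = fun ω => B.weight v C j t ω * B.factor v C j (t + 1) ω :=
      funext fun ω => B.weight_succ j t ω
    rw [this]
    exact (ih.mono (B.hist.mono (Nat.le_succ t)) le_rfl).mul (B.measurable_factor j hC t)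

lemma pre_le (t : ℕ) : B.pre (t + 1) ≤ mΩ := (B.pre_le_hist t).trans (B.hist.le _)

variable [IsProbabilityMeasure P]

lemma integrable_weight (hC : MeasurableSet C) (hv : 0 < v) (hv1 : v ≤ 1) (t : ℕ) :
    Integrable (B.weight v C j t) P := by
  refine Integrable.of_bound ((B.measurable_weight j hC t).mono (B.hist.le t)
    le_rfl).aestronglyMeasurable (v⁻¹ ^ t) (ae_of_all _ fun ω => ?_)
  rw [Real.norm_of_nonneg (B.weight_nonneg j hv t ω)]
  exact B.weight_le j hv hv1 t ω

lemma integrable_indicator_mul_weight {A : Set Ω} (hA : MeasurableSet A) (hC : MeasurableSet C)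
    (hv : 0 < v) (hv1 : v ≤ 1) (t : ℕ) :
    Integrable (fun ω => A.indicator (fun _ => (1 : ℝ)) ω * B.weight v C j t ω) P := by
  have : (fun ω => A.indicator (fun _ => (1 : ℝ)) ω * B.weight v C j t ω)
      = A.indicator (B.weight v C j t) := by
    ext ω
    by_cases h : ω ∈ A <;> simp [h]
  rw [this]
  exact (B.integrable_weight j hC hv hv1 t).indicator hA

/-- The choice of arm and the past weight are known before the attack coin and the clean reward are
drawn, so both are independent of `H`. The attack value never enters. -/
lemma integral_weight_succ_add_le (hC : MeasurableSet C) {δ : ℝ} (hδ : 0 < δ) (hδ' : δ < 1 / 2)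
    (hρ : 0 ≤ ρ) (hp : (ν j).real C + ρ ≤ 1 / 2 - δ) (t : ℕ) :
    ∫ ω, B.weight (1 - 2 * δ) C j (t + 1) ω ∂P + 2 * δ ^ 2 *
      ∫ ω, {ω | B.arm (t + 1) ω = j}.indicator (fun _ => (1 : ℝ)) ω *
        B.weight (1 - 2 * δ) C j t ω ∂P ≤ ∫ ω, B.weight (1 - 2 * δ) C j t ω ∂P := by
  have hv : 0 < 1 - 2 * δ := by linarith
  have hv1 : 1 - 2 * δ ≤ 1 := by linarith
  set v := 1 - 2 * δ with hv_def
  set A := {ω | B.arm (t + 1) ω = j} with hA_def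
  set D := {ω | B.attacked (t + 1) ω = true} with hD_def
  set E := B.clean (t + 1) j ⁻¹' C with hE_def
  set H : Ω → ℝ := fun ω => A.indicator (fun _ => (1 : ℝ)) ω * B.weight v C j t ω with hH_def
  have hA : MeasurableSet[B.pre (t + 1)] A := B.measurableSet_arm_eq j t
  have hHm : Measurable[B.pre (t + 1)] H :=
    ((@measurable_const _ _ _ (B.pre (t + 1)) (1 : ℝ)).indicator hA).mul
      ((B.measurable_weight j hC t).mono (B.hist_le_pre t) le_rfl)
  have hHi : Integrable H P :=
    B.integrable_indicator_mul_weight j (B.pre_le t _ hA) hC hv hv1 t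
  have hH0 : ∀ ω, 0 ≤ H ω := fun ω =>
    mul_nonneg (Set.indicator_nonneg (fun _ _ => zero_le_one) ω) (B.weight_nonneg j hv t ω)
  have hDm : MeasurableSet[MeasurableSpace.comap (B.attacked (t + 1)) inferInstance] D :=
    ⟨{true}, measurableSet_singleton _, rfl⟩
  have hEm : MeasurableSet[MeasurableSpace.comap (B.clean (t + 1) j) inferInstance] E :=
    ⟨C, hC, rfl⟩
  have hatt : Measurable (B.attacked (t + 1)) :=
    (B.attacked_measurable t).mono (B.hist.le _) le_rfl
  have hcl : Measurable (B.clean (t + 1) j) := (B.clean_measurable t j).mono (B.hist.le _) le_rfl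
  have hD : ∫ ω, D.indicator (fun _ => (1 : ℝ)) ω * H ω ∂P = ρ * ∫ ω, H ω ∂P := by
    rw [integral_indicator_mul_of_indep hatt.comap_le (B.pre_le t) (B.attacked_indep t) hDm hHm,
      measureReal_def, B.attacked_prob t, ENNReal.toReal_ofReal hρ]
  have hE : ∫ ω, E.indicator (fun _ => (1 : ℝ)) ω * H ω ∂P = (ν j).real C * ∫ ω, H ω ∂P := by
    rw [integral_indicator_mul_of_indep hcl.comap_le (B.pre_le t) (B.clean_indep t j) hEm hHm,
      measureReal_def, measureReal_def, ← B.clean_law t j, Measure.map_apply hcl hC]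
  have hint : ∀ F : Set Ω, MeasurableSet F →
      Integrable (fun ω => F.indicator (fun _ => (1 : ℝ)) ω * H ω) P := by
    intro F hF
    have : (fun ω => F.indicator (fun _ => (1 : ℝ)) ω * H ω) = F.indicator H := by
      ext ω
      by_cases h : ω ∈ F <;> simp [h]
    rw [this]
    exact hHi.indicator hF
  have hDi := hint D (hatt.comap_le _ hDm)
  have hEi := hint E (hcl.comap_le _ hEm)
  have hWi := B.integrable_weight j hC hv hv1 t
  have hvv : 0 ≤ v⁻¹ - v := by
    have : 1 ≤ v⁻¹ := (one_le_inv₀ hv).2 hv1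
    linarith
  -- A union bound over `D` and `E`: the attack and the clean reward need not be independent of each
  -- other.
  have hpt : ∀ ω, B.weight v C j (t + 1) ω ≤ B.weight v C j t ω + (v - 1) * H ω
      + ((v⁻¹ - v) * (D.indicator (fun _ => (1 : ℝ)) ω * H ω)
        + (v⁻¹ - v) * (E.indicator (fun _ => (1 : ℝ)) ω * H ω)) := by
    intro ω
    rw [B.weight_succ]
    have hW := B.weight_nonneg (C := C) j hv t ω
    have hp := mul_nonneg hvv hW
    by_cases hωA : B.arm (t + 1) ω = j
    · have hHω : H ω = B.weight v C j t ω := by simp [hH_def, hA_def, hωA]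
      rw [hHω]
      by_cases hωD : ω ∈ D <;> by_cases hωE : ω ∈ E <;>
        simp only [factor, hωA, misleading, ← hD_def, ← hE_def, Set.mem_union, hωD, hωE, if_true,
          if_false, or_true, or_false, Set.indicator_of_mem, Set.indicator_of_notMem,
          not_false_eq_true, or_self] <;>
        nlinarith
    · have hHω : H ω = 0 := by simp [hH_def, hA_def, hωA]
      simp [factor, hωA, hHω]
  have hmono := integral_mono (B.integrable_weight j hC hv hv1 (t + 1))
    ((hWi.add (hHi.const_mul (v - 1))).add ((hDi.const_mul (v⁻¹ - v)).add
      (hEi.const_mul (v⁻¹ - v)))) hpt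
  have hsum := integral_add (hWi.add (hHi.const_mul (v - 1)))
    ((hDi.const_mul (v⁻¹ - v)).add (hEi.const_mul (v⁻¹ - v)))
  have hsum₁ := integral_add hWi (hHi.const_mul (v - 1))
  have hsum₂ := integral_add (hDi.const_mul (v⁻¹ - v)) (hEi.const_mul (v⁻¹ - v))
  simp only [Pi.add_apply] at hsum hmono
  rw [hsum, hsum₁, hsum₂] at hmono
  simp only [integral_const_mul] at hmono
  rw [hD, hE] at hmono
  have hI : 0 ≤ ∫ ω, H ω ∂P := integral_nonneg hH0
  -- Since `1/2 - δ = v/2`, the worst case of the left side is `(v - 1) + (1 - v²)/2 = -(1 - v)²/2 =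
  -- -2δ²`.
  have hkey : (v - 1) + (v⁻¹ - v) * ((ν j).real C + ρ) ≤ -(2 * δ ^ 2) := by
    have h1 : (v⁻¹ - v) * ((ν j).real C + ρ) ≤ (v⁻¹ - v) * (1 / 2 - δ) :=
      mul_le_mul_of_nonneg_left hp hvv
    have h2 : v⁻¹ * (1 / 2 - δ) = 1 / 2 := by
      have : 1 / 2 - δ = v / 2 := by rw [hv_def]; ring
      rw [this]
      field_simp
    have h3 : (v⁻¹ - v) * (1 / 2 - δ) = 1 / 2 - v * (1 / 2 - δ) := by rw [sub_mul, h2]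
    rw [h3] at h1
    rw [hv_def] at h1 ⊢
    nlinarith
  have := mul_le_mul_of_nonneg_right hkey hI
  change _ + 2 * δ ^ 2 * ∫ ω, H ω ∂P ≤ _
  linarith

end

/-! ### From weights to medians; exploration events; regret as a sum over pulls. -/

section

variable {K : ℕ} {ν : Fin K → Measure ℝ} {ρ : ℝ} {Ω : Type*} [mΩ : MeasurableSpace Ω]
  {P : Measure Ω} (B : AttackedBandit ν ρ P) {v : ℝ} {C : Set ℝ} (j : Fin K)

open Classical in
-- Each factor `v` is cancelled by a `v⁻¹`, and the factors left over are at least `1`.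
lemma one_le_weight (hv : 0 < v) (hv1 : v ≤ 1) (t : ℕ) (ω : Ω)
    (h : (B.pulls j t ω).card
      ≤ 2 * ((B.pulls j t ω).filter fun τ => ω ∈ B.misleading C j τ).card) :
    1 ≤ B.weight v C j t ω := by
  have hW : B.weight v C j t ω
      = ∏ τ ∈ B.pulls j t ω, if ω ∈ B.misleading C j τ then v⁻¹ else v := by
    rw [pulls, Finset.prod_filter]
    rfl
  rw [hW, Finset.prod_ite, Finset.prod_const, Finset.prod_const]
  have hcard := Finset.card_filter_add_card_filter_not (s := B.pulls j t ω)
    fun τ => ω ∈ B.misleading C j τ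
  set a := ((B.pulls j t ω).filter fun τ => ω ∈ B.misleading C j τ).card
  set b := ((B.pulls j t ω).filter fun τ => ¬ ω ∈ B.misleading C j τ).card
  have hba : b ≤ a := by omega
  calc (1 : ℝ) = v⁻¹ ^ b * v ^ b := by rw [← mul_pow, inv_mul_cancel₀ hv.ne', one_pow]
    _ ≤ v⁻¹ ^ a * v ^ b :=
      mul_le_mul_of_nonneg_right (pow_le_pow_right₀ ((one_le_inv₀ hv).2 hv1) hba) (by positivity)

lemma mem_misleading_of_observed_mem {τ : ℕ} {ω : Ω} (harm : B.arm τ ω = j)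
    (hobs : B.observed τ ω ∈ C) : ω ∈ B.misleading C j τ := by
  by_cases hatt : B.attacked τ ω = true
  · exact Or.inl hatt
  · right
    simpa [observed, harm, hatt] using hobs

lemma med_le_of_weight_lt_one {x₀ : ℝ} (hv : 0 < v) (hv1 : v ≤ 1) (t : ℕ) (ω : Ω)
    (hpos : 0 < (B.pulls j t ω).card) (h : B.weight v (Set.Ioi x₀) j t ω < 1) :
    B.med j t ω ≤ x₀ := by
  classical
  have hfew := not_le.1 fun hle => (B.one_le_weight j hv hv1 t ω hle).not_gt h
  refine sampleMedian_le _ _ _ hpos ?_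
  have hcard := Finset.card_filter_add_card_filter_not (s := B.pulls j t ω)
    fun τ => ω ∈ B.misleading (Set.Ioi x₀) j τ
  have hsub : ((B.pulls j t ω).filter fun τ => ¬ ω ∈ B.misleading (Set.Ioi x₀) j τ)
      ⊆ (B.pulls j t ω).filter fun τ => B.observed τ ω ≤ x₀ := by
    intro τ hτ
    rw [Finset.mem_filter] at hτ ⊢
    refine ⟨hτ.1, not_lt.1 fun hlt => hτ.2 ?_⟩
    exact B.mem_misleading_of_observed_mem j (Finset.mem_filter.1 hτ.1).2 hlt
  have := Finset.card_le_card hsub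
  omega

lemma lt_med_of_weight_lt_one {x₀ : ℝ} (hv : 0 < v) (hv1 : v ≤ 1) (t : ℕ) (ω : Ω)
    (h : B.weight v (Set.Iic x₀) j t ω < 1) : x₀ < B.med j t ω := by
  classical
  have hfew := not_le.1 fun hle => (B.one_le_weight j hv hv1 t ω hle).not_gt h
  refine lt_sampleMedian _ _ _ (lt_of_le_of_lt (Nat.mul_le_mul_left 2 ?_) hfew)
  refine Finset.card_le_card fun τ hτ => ?_
  rw [Finset.mem_filter] at hτ ⊢
  exact ⟨hτ.1, B.mem_misleading_of_observed_mem j (Finset.mem_filter.1 hτ.1).2 hτ.2⟩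

lemma measurableSet_arm_eq_ambient (t : ℕ) : MeasurableSet {ω | B.arm (t + 1) ω = j} :=
  B.pre_le t _ (B.measurableSet_arm_eq j t)

/-- In a round after the initial phase, arm `j` is explored on an event `G j` of probability
`c / (t + 1)` that is independent of the past, and it has the largest median if it is pulled
outside of `G j`. -/
lemma IsMedEpsGreedy.exploration {B : AttackedBandit ν ρ P} {c : ℝ} (hB : B.IsMedEpsGreedy c)
    (hc : 0 < c) {t : ℕ} (ht : ⌈c⌉₊ * K ≤ t) :
    ∃ G : Fin K → Set Ω, (∀ j, MeasurableSet (G j)) ∧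
      (∀ j, P.real (G j) = c / ((t : ℝ) + 1)) ∧
      (∀ j, ∀ ω ∈ G j, B.arm (t + 1) ω = j) ∧
      (∀ j, ∀ H : Ω → ℝ, Measurable[B.hist t] H →
        ∫ ω, (G j).indicator (fun _ => (1 : ℝ)) ω * H ω ∂P = c / ((t : ℝ) + 1) * ∫ ω, H ω ∂P) ∧
      ∀ j, ∀ ω ∉ G j, B.arm (t + 1) ω = j → ∀ i, B.med i t ω ≤ B.med j t ω := by
  obtain ⟨explore, unif, h⟩ := hB.step
  obtain ⟨hexp, hunif, hind, hind', hPe, hPu, harm, hmed⟩ := h t ht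
  have hexp' : Measurable (explore (t + 1)) := hexp.mono (B.pre_le t) le_rfl
  have hunif' : Measurable (unif (t + 1)) := hunif.mono (B.pre_le t) le_rfl
  set G : Fin K → Set Ω := fun j => explore (t + 1) ⁻¹' {true} ∩ unif (t + 1) ⁻¹' {j} with hG
  have hGm : ∀ j, MeasurableSet (G j) := fun j =>
    (hexp' (measurableSet_singleton _)).inter (hunif' (measurableSet_singleton _))
  have hGP : ∀ j, P.real (G j) = c / ((t : ℝ) + 1) := by
    intro j
    have hK : (0 : ℝ) < K := by exact_mod_cast j.pos
    have h1 := hind'.measure_inter_preimage_eq_mul {true} {j} (measurableSet_singleton _)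
      (measurableSet_singleton _)
    have h2 : P (explore (t + 1) ⁻¹' {true}) = ENNReal.ofReal (c * (K : ℝ) / ((t : ℝ) + 1)) := hPe
    have h3 : P (unif (t + 1) ⁻¹' {j}) = ENNReal.ofReal (1 / (K : ℝ)) := hPu j
    rw [measureReal_def, h1, h2, h3, ENNReal.toReal_mul, ENNReal.toReal_ofReal (by positivity),
      ENNReal.toReal_ofReal (by positivity)]
    field_simp
  refine ⟨G, hGm, hGP, ?_, ?_, ?_⟩
  · rintro j ω ⟨h1, h2⟩
    exact (harm ω h1).trans h2
  · intro j H hH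
    have hpair : Measurable fun ω => (explore (t + 1) ω, unif (t + 1) ω) := hexp'.prodMk hunif'
    have hGj : MeasurableSet[MeasurableSpace.comap
        (fun ω => (explore (t + 1) ω, unif (t + 1) ω)) inferInstance] (G j) :=
      ⟨{true} ×ˢ {j}, (measurableSet_singleton _).prod (measurableSet_singleton _), rfl⟩
    rw [integral_indicator_mul_of_indep hpair.comap_le (B.hist.le t) hind hGj hH, hGP]
  · intro j ω hω hj i
    -- An exploration round that pulls `j` has drawn `j` uniformly, hence lies in `G j`.
    have hne : explore (t + 1) ω = false := by
      by_contra hne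
      rw [Bool.not_eq_false] at hne
      exact hω ⟨hne, (harm ω hne).symm.trans hj⟩
    exact hj ▸ hmed ω hne i

lemma IsMedEpsGreedy.ceil_le_card_pulls {B : AttackedBandit ν ρ P} {c : ℝ}
    (hB : B.IsMedEpsGreedy c) {t : ℕ} (ht : ⌈c⌉₊ * K ≤ t) (ω : Ω) :
    ⌈c⌉₊ ≤ (B.pulls j t ω).card := by
  rw [← hB.init j ω]
  exact Finset.card_le_card (Finset.filter_subset_filter _ (Finset.Icc_subset_Icc_right ht))

variable [IsProbabilityMeasure P]

lemma pseudoRegret_eq (iStar : Fin K) (T : ℕ) :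
    B.pseudoRegret iStar T = ∑ t ∈ Finset.Icc 1 T, ∑ j ∈ Finset.univ.erase iStar,
      (mean (ν iStar) - mean (ν j)) * P.real {ω | B.arm t ω = j} := by
  have hint : ∀ t ∈ Finset.Icc 1 T, ∀ i, Integrable
      ({ω | B.arm t ω = i}.indicator fun _ => (1 : ℝ)) P := by
    intro t ht i
    obtain ⟨t, rfl⟩ := Nat.exists_eq_add_of_le' (Finset.mem_Icc.1 ht).1
    exact (integrable_const 1).indicator (B.measurableSet_arm_eq_ambient i t)
  have hP : ∀ t ∈ Finset.Icc 1 T, ∀ i, ∫ ω, {ω | B.arm t ω = i}.indicator (fun _ => (1 : ℝ)) ω ∂P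
      = P.real {ω | B.arm t ω = i} := by
    intro t ht i
    obtain ⟨t, rfl⟩ := Nat.exists_eq_add_of_le' (Finset.mem_Icc.1 ht).1
    rw [integral_indicator (B.measurableSet_arm_eq_ambient i t)]
    simp
  have hpt : ∀ t ω, mean (ν (B.arm t ω)) = mean (ν iStar) - ∑ j ∈ Finset.univ.erase iStar,
      (mean (ν iStar) - mean (ν j)) * {ω | B.arm t ω = j}.indicator (fun _ => (1 : ℝ)) ω := by
    intro t ω
    have h1 : ∑ j ∈ Finset.univ.erase iStar, (mean (ν iStar) - mean (ν j))
        * {ω | B.arm t ω = j}.indicator (fun _ => (1 : ℝ)) ω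
        = ∑ j, (mean (ν iStar) - mean (ν j))
          * {ω | B.arm t ω = j}.indicator (fun _ => (1 : ℝ)) ω :=
      Finset.sum_erase _ (by simp)
    rw [h1, Finset.sum_eq_single (B.arm t ω)]
    · simp
    · intro i _ hi
      simp [hi.symm]
    · simp
  have hinner : ∀ t ∈ Finset.Icc 1 T, Integrable (fun ω => ∑ j ∈ Finset.univ.erase iStar,
      (mean (ν iStar) - mean (ν j)) * {ω | B.arm t ω = j}.indicator (fun _ => (1 : ℝ)) ω) P :=
    fun t ht => integrable_finsetSum _ fun i _ => (hint t ht i).const_mul _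
  have hE : ∀ t ∈ Finset.Icc 1 T, ∫ ω, mean (ν (B.arm t ω)) ∂P = mean (ν iStar)
      - ∑ j ∈ Finset.univ.erase iStar, (mean (ν iStar) - mean (ν j))
        * P.real {ω | B.arm t ω = j} := by
    intro t ht
    simp_rw [hpt t]
    rw [integral_sub (integrable_const _) (hinner t ht), integral_finsetSum _
      fun i _ => (hint t ht i).const_mul _]
    simp only [integral_const_mul, hP t ht]
    simp
  rw [pseudoRegret, integral_finsetSum, Finset.sum_congr rfl hE, Finset.sum_sub_distrib]
  · simp
    ring
  · intro t ht
    simp_rw [hpt t]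
    exact (integrable_const _).sub (hinner t ht)

lemma sum_prob_arm_eq (t : ℕ) : ∑ τ ∈ Finset.Icc 1 t, P.real {ω | B.arm τ ω = j}
    = ∫ ω, ((B.pulls j t ω).card : ℝ) ∂P := by
  have hcard : ∀ ω, ((B.pulls j t ω).card : ℝ)
      = ∑ τ ∈ Finset.Icc 1 t, {ω | B.arm τ ω = j}.indicator (fun _ => (1 : ℝ)) ω := by
    intro ω
    simp [pulls, Set.indicator_apply]
  simp_rw [hcard]
  rw [integral_finsetSum]
  · refine Finset.sum_congr rfl fun τ hτ => ?_
    obtain ⟨τ, rfl⟩ := Nat.exists_eq_add_of_le' (Finset.mem_Icc.1 hτ).1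
    rw [integral_indicator (B.measurableSet_arm_eq_ambient j τ)]
    simp
  · intro τ hτ
    obtain ⟨τ, rfl⟩ := Nat.exists_eq_add_of_le' (Finset.mem_Icc.1 hτ).1
    exact (integrable_const 1).indicator (B.measurableSet_arm_eq_ambient j τ)

end

/-! ### One-round estimates and the regret bound. -/

section

variable {K : ℕ} {ν : Fin K → Measure ℝ} {ρ : ℝ} {Ω : Type*} [mΩ : MeasurableSpace Ω]
  {P : Measure Ω} [IsProbabilityMeasure P] (B : AttackedBandit ν ρ P)

lemma integral_weight_le_one {C : Set ℝ} (j : Fin K) (hC : MeasurableSet C) {δ : ℝ} (hδ : 0 < δ)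
    (hδ' : δ < 1 / 2) (hρ : 0 ≤ ρ) (hp : (ν j).real C + ρ ≤ 1 / 2 - δ) (t : ℕ) :
    ∫ ω, B.weight (1 - 2 * δ) C j t ω ∂P ≤ 1 := by
  induction t with
  | zero => simp [weight]
  | succ t ih =>
    have h := B.integral_weight_succ_add_le j hC hδ hδ' hρ hp t
    have h0 : 0 ≤ ∫ ω, {ω | B.arm (t + 1) ω = j}.indicator (fun _ => (1 : ℝ)) ω *
        B.weight (1 - 2 * δ) C j t ω ∂P := integral_nonneg fun ω =>
      mul_nonneg (Set.indicator_nonneg (fun _ _ => zero_le_one) ω)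
        (B.weight_nonneg j (by linarith) t ω)
    have := mul_nonneg (by positivity : 0 ≤ 2 * δ ^ 2) h0
    linarith

variable {B}

/-- The expected regret of one round after the initial phase. -/
lemma IsMedEpsGreedy.regret_step_le {c : ℝ} (hB : B.IsMedEpsGreedy c) (hc : 0 < c)
    (iStar : Fin K) {Δ : Fin K → ℝ} {D x₀ v : ℝ} (hv : 0 < v) (hv1 : v ≤ 1)
    (hΔ : ∀ j, j ≠ iStar → 0 ≤ Δ j) (hD : 0 ≤ D) (hΔD : ∀ j, j ≠ iStar → Δ j ≤ D)
    {t : ℕ} (ht : ⌈c⌉₊ * K ≤ t) :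
    ∑ j ∈ Finset.univ.erase iStar, Δ j * P.real {ω | B.arm (t + 1) ω = j} ≤
      ∑ j ∈ Finset.univ.erase iStar, Δ j * (c / ((t : ℝ) + 1) +
        ∫ ω, {ω | B.arm (t + 1) ω = j}.indicator (fun _ => (1 : ℝ)) ω *
          B.weight v (Set.Ioi x₀) j t ω ∂P)
      + D * ∫ ω, B.weight v (Set.Iic x₀) iStar t ω ∂P := by
  obtain ⟨G, hGm, hGP, -, -, hmed⟩ := hB.exploration hc ht
  set A : Fin K → Set Ω := fun j => {ω | B.arm (t + 1) ω = j} with hA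
  have hAm : ∀ j, MeasurableSet (A j) := fun j => B.measurableSet_arm_eq_ambient j t
  have hI : ∀ F : Set Ω, MeasurableSet F → Integrable (F.indicator fun _ => (1 : ℝ)) P :=
    fun F hF => (integrable_const 1).indicator hF
  have hI1 : ∀ F : Set Ω, MeasurableSet F →
      ∫ ω, F.indicator (fun _ => (1 : ℝ)) ω ∂P = P.real F := by
    intro F hF
    rw [integral_indicator hF]
    simp
  have hHi : ∀ j, Integrable (fun ω => (A j).indicator (fun _ => (1 : ℝ)) ω *
      B.weight v (Set.Ioi x₀) j t ω) P := fun j =>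
    B.integrable_indicator_mul_weight j (hAm j) measurableSet_Ioi hv hv1 t
  have hWi := B.integrable_weight iStar (measurableSet_Iic (a := x₀)) hv hv1 t
  -- If all three terms were too small, the median of `j` would be at most `x₀` and that of `iStar`
  -- above it, against the greedy choice.
  have hone : ∀ j, j ≠ iStar → ∀ ω, (A j).indicator (fun _ => (1 : ℝ)) ω ≤
      (G j).indicator (fun _ => (1 : ℝ)) ω
      + (A j).indicator (fun _ => (1 : ℝ)) ω * B.weight v (Set.Ioi x₀) j t ω
      + (A j).indicator (fun _ => (1 : ℝ)) ω * B.weight v (Set.Iic x₀) iStar t ω := by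
    intro j hj ω
    have hw := B.weight_nonneg (C := Set.Ioi x₀) j hv t ω
    have hw' := B.weight_nonneg (C := Set.Iic x₀) iStar hv t ω
    have hG0 : 0 ≤ (G j).indicator (fun _ => (1 : ℝ)) ω :=
      Set.indicator_nonneg (fun _ _ => zero_le_one) ω
    by_cases hω : ω ∈ A j
    · rw [Set.indicator_of_mem hω, one_mul, one_mul]
      by_cases hωG : ω ∈ G j
      · rw [Set.indicator_of_mem hωG]
        linarith
      by_contra! hlt
      have hpos : 0 < (B.pulls j t ω).card :=
        (Nat.ceil_pos.2 hc).trans_le (hB.ceil_le_card_pulls j ht ω)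
      have h1 := B.med_le_of_weight_lt_one (x₀ := x₀) j hv hv1 t ω hpos (by linarith)
      have h2 := B.lt_med_of_weight_lt_one (x₀ := x₀) iStar hv hv1 t ω (by linarith)
      have h3 := hmed j ω hωG hω iStar
      linarith
    · simpa [Set.indicator_of_notMem hω] using hG0
  have hpt : ∀ ω, ∑ j ∈ Finset.univ.erase iStar, Δ j * (A j).indicator (fun _ => (1 : ℝ)) ω ≤
      ∑ j ∈ Finset.univ.erase iStar, Δ j * ((G j).indicator (fun _ => (1 : ℝ)) ω +
        (A j).indicator (fun _ => (1 : ℝ)) ω * B.weight v (Set.Ioi x₀) j t ω)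
      + D * B.weight v (Set.Iic x₀) iStar t ω := by
    intro ω
    have hw' := B.weight_nonneg (C := Set.Iic x₀) iStar hv t ω
    -- Only one arm is pulled per round, so a wrong median of `iStar` costs `D` once and not once
    -- per arm.
    have hDsum : ∑ j ∈ Finset.univ.erase iStar, Δ j * (A j).indicator (fun _ => (1 : ℝ)) ω
        ≤ D := by
      have hA0 : ∀ i, i ≠ B.arm (t + 1) ω → (A i).indicator (fun _ => (1 : ℝ)) ω = 0 :=
        fun i hi => Set.indicator_of_notMem (s := A i) (fun h : ω ∈ A i => hi (Eq.symm h)) _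
      have hle : ∀ i, (A i).indicator (fun _ => (1 : ℝ)) ω ≤ 1 :=
        fun i => Set.indicator_le_self' (fun _ _ => zero_le_one) ω
      by_cases hs : B.arm (t + 1) ω = iStar
      · rw [Finset.sum_eq_zero]
        · exact hD
        · intro i hi
          rw [hA0 i (hs ▸ Finset.ne_of_mem_erase hi), mul_zero]
      · rw [Finset.sum_eq_single_of_mem (B.arm (t + 1) ω)
          (Finset.mem_erase.2 ⟨hs, Finset.mem_univ _⟩) fun i _ hi => by rw [hA0 i hi, mul_zero]]
        exact (mul_le_of_le_one_right (hΔ _ hs) (hle _)).trans (hΔD _ hs)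
    calc ∑ j ∈ Finset.univ.erase iStar, Δ j * (A j).indicator (fun _ => (1 : ℝ)) ω
        ≤ ∑ j ∈ Finset.univ.erase iStar, (Δ j * ((G j).indicator (fun _ => (1 : ℝ)) ω +
          (A j).indicator (fun _ => (1 : ℝ)) ω * B.weight v (Set.Ioi x₀) j t ω)
          + Δ j * (A j).indicator (fun _ => (1 : ℝ)) ω * B.weight v (Set.Iic x₀) iStar t ω) := by
          refine Finset.sum_le_sum fun j hj => ?_
          have hj' := Finset.ne_of_mem_erase hj
          have := mul_le_mul_of_nonneg_left (hone j hj' ω) (hΔ j hj')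
          linarith
      _ ≤ _ := by
        rw [Finset.sum_add_distrib, ← Finset.sum_mul]
        gcongr
  have hmono := integral_mono
    (integrable_finsetSum (Finset.univ.erase iStar) fun j _ => (hI _ (hAm j)).const_mul (Δ j))
    ((integrable_finsetSum (Finset.univ.erase iStar) fun j _ =>
      ((hI _ (hGm j)).add (hHi j)).const_mul (Δ j)).add (hWi.const_mul D)) hpt
  have hadd := integral_add (integrable_finsetSum (Finset.univ.erase iStar) fun j _ =>
      ((hI _ (hGm j)).add (hHi j)).const_mul (Δ j)) (hWi.const_mul D)
  have hadd' : ∀ j, ∫ ω, ((G j).indicator (fun _ => (1 : ℝ)) ω +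
        (A j).indicator (fun _ => (1 : ℝ)) ω * B.weight v (Set.Ioi x₀) j t ω) ∂P
      = c / ((t : ℝ) + 1) + ∫ ω, (A j).indicator (fun _ => (1 : ℝ)) ω *
        B.weight v (Set.Ioi x₀) j t ω ∂P := by
    intro j
    rw [integral_add (hI _ (hGm j)) (hHi j), hI1 _ (hGm j), hGP]
  have hfin := integral_finsetSum (Finset.univ.erase iStar) fun j _ =>
    ((hI _ (hGm j)).add (hHi j)).const_mul (Δ j)
  simp only [Pi.add_apply] at hadd hfin hmono
  rw [hadd, hfin, integral_finsetSum _ fun j _ => (hI _ (hAm j)).const_mul (Δ j)] at hmono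
  simp only [integral_const_mul, hadd', hI1 _ (hAm _)] at hmono
  exact hmono

/-- Exploration alone pulls `j` with probability `c / (t + 1)` independently of the past, which
turns the drift per pull into a drift per round. -/
lemma IsMedEpsGreedy.integral_weight_succ_le {c : ℝ} (hB : B.IsMedEpsGreedy c) (hc : 0 < c)
    {C : Set ℝ} (j : Fin K) (hC : MeasurableSet C) {δ : ℝ} (hδ : 0 < δ)
    (hδ' : δ < 1 / 2) (hρ : 0 ≤ ρ) (hp : (ν j).real C + ρ ≤ 1 / 2 - δ) {t : ℕ}
    (ht : ⌈c⌉₊ * K ≤ t) :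
    ∫ ω, B.weight (1 - 2 * δ) C j (t + 1) ω ∂P
        + 2 * δ ^ 2 * (c / ((t : ℝ) + 1) * ∫ ω, B.weight (1 - 2 * δ) C j t ω ∂P)
      ≤ ∫ ω, B.weight (1 - 2 * δ) C j t ω ∂P := by
  obtain ⟨G, hGm, -, hGarm, hGind, -⟩ := hB.exploration hc ht
  have hv : 0 < 1 - 2 * δ := by linarith
  have hv1 : 1 - 2 * δ ≤ 1 := by linarith
  rw [← hGind j _ (B.measurable_weight j hC t)]
  refine le_trans ?_ (B.integral_weight_succ_add_le j hC hδ hδ' hρ hp t)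
  have : ∫ ω, (G j).indicator (fun _ => (1 : ℝ)) ω * B.weight (1 - 2 * δ) C j t ω ∂P
      ≤ ∫ ω, {ω | B.arm (t + 1) ω = j}.indicator (fun _ => (1 : ℝ)) ω *
        B.weight (1 - 2 * δ) C j t ω ∂P := by
    refine integral_mono (B.integrable_indicator_mul_weight j (hGm j) hC hv hv1 t)
      (B.integrable_indicator_mul_weight j (B.measurableSet_arm_eq_ambient j t) hC hv hv1 t) fun ω => ?_
    exact mul_le_mul_of_nonneg_right (Set.indicator_le_indicator_of_subset
      (fun ω hω => hGarm j ω hω) (fun _ => zero_le_one) ω) (B.weight_nonneg j hv t ω)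
  gcongr

lemma IsMedEpsGreedy.pseudoRegret_le {c : ℝ} (hB : B.IsMedEpsGreedy c) (hc : 0 < c)
    (iStar : Fin K) {D x₀ δ : ℝ} (hmean : ∀ j, j ≠ iStar → mean (ν j) ≤ mean (ν iStar))
    (hD : 0 ≤ D) (hmeanD : ∀ j, j ≠ iStar → mean (ν iStar) - mean (ν j) ≤ D)
    (hδ : 0 < δ) (hδ' : δ < 1 / 2) (hδc : 2 ≤ c * δ ^ 2) (hρ : 0 ≤ ρ)
    (hstar : (ν iStar).real (Set.Iic x₀) + ρ ≤ 1 / 2 - δ)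
    (hother : ∀ j, j ≠ iStar → (ν j).real (Set.Ioi x₀) + ρ ≤ 1 / 2 - δ) {T : ℕ} (hT : 1 ≤ T) :
    B.pseudoRegret iStar T ≤ ∑ j ∈ Finset.univ.erase iStar, (mean (ν iStar) - mean (ν j)) *
      (⌈c⌉₊ + c * Real.log T + c / 4) + D * (⌈c⌉₊ * K : ℕ) := by
  have hv : 0 < 1 - 2 * δ := by linarith
  have hv1 : 1 - 2 * δ ≤ 1 := by linarith
  set Δ : Fin K → ℝ := fun j => mean (ν iStar) - mean (ν j) with hΔdef
  have hΔ : ∀ j, j ≠ iStar → 0 ≤ Δ j := fun j hj => sub_nonneg.2 (hmean j hj)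
  set m := ⌈c⌉₊ * K with hm
  have hm1 : 1 ≤ m := Nat.mul_pos (Nat.ceil_pos.2 hc) iStar.pos
  have hinit : ∀ j, ∑ τ ∈ Finset.Icc 1 m, P.real {ω | B.arm τ ω = j} = ⌈c⌉₊ := by
    intro j
    rw [B.sum_prob_arm_eq, hm]
    simp [hB.init j]
  set a : ℕ → ℝ := fun t => ∫ ω, B.weight (1 - 2 * δ) (Set.Iic x₀) iStar t ω ∂P with ha
  set b : Fin K → ℕ → ℝ :=
    fun j t => ∫ ω, B.weight (1 - 2 * δ) (Set.Ioi x₀) j t ω ∂P with hb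
  have ha0 : ∀ t, 0 ≤ a t := fun t => integral_nonneg fun ω => B.weight_nonneg iStar hv t ω
  have hb0 : ∀ j t, 0 ≤ b j t := fun j t => integral_nonneg fun ω => B.weight_nonneg j hv t ω
  have ha1 : ∀ t, a t ≤ 1 :=
    B.integral_weight_le_one iStar measurableSet_Iic hδ hδ' hρ hstar
  have hb1 : ∀ j, j ≠ iStar → ∀ t, b j t ≤ 1 := fun j hj =>
    B.integral_weight_le_one j measurableSet_Ioi hδ hδ' hρ (hother j hj)
  have hlog0 : 0 ≤ Real.log T := Real.log_natCast_nonneg T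
  -- Within the initial phase the pulls of each arm are at most `⌈c⌉₊`; the induction starts only at
  -- `m`.
  rcases le_total T m with hTm | hTm
  · rw [B.pseudoRegret_eq, Finset.sum_comm]
    have : ∑ j ∈ Finset.univ.erase iStar, ∑ t ∈ Finset.Icc 1 T,
        Δ j * P.real {ω | B.arm t ω = j} ≤ ∑ j ∈ Finset.univ.erase iStar, Δ j *
          (⌈c⌉₊ + c * Real.log T + c / 4) := by
      refine Finset.sum_le_sum fun j hj => ?_
      rw [← Finset.mul_sum]
      refine mul_le_mul_of_nonneg_left ?_ (hΔ j (Finset.ne_of_mem_erase hj))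
      have hsub : ∑ τ ∈ Finset.Icc 1 T, P.real {ω | B.arm τ ω = j}
          ≤ ∑ τ ∈ Finset.Icc 1 m, P.real {ω | B.arm τ ω = j} :=
        Finset.sum_le_sum_of_subset_of_nonneg (Finset.Icc_subset_Icc_right hTm)
          fun _ _ _ => measureReal_nonneg
      rw [hinit j] at hsub
      have := mul_nonneg hc.le hlog0
      linarith
    have hDm : 0 ≤ D * (m : ℝ) := by positivity
    linarith
  -- The bound carries the potentials `c / 4 * b j T` and `D * (T * a T)`: their decrease in a round
  -- pays for that round's wrong medians.
  · have key : ∀ T, m ≤ T → B.pseudoRegret iStar T ≤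
        ∑ j ∈ Finset.univ.erase iStar, Δ j *
          (⌈c⌉₊ + c * Real.log T + c / 4 * (1 - b j T)) + D * (m - T * a T) := by
      intro T hT
      induction T, hT using Nat.le_induction with
      | base =>
        rw [B.pseudoRegret_eq, Finset.sum_comm]
        have : ∑ j ∈ Finset.univ.erase iStar, ∑ t ∈ Finset.Icc 1 m,
            Δ j * P.real {ω | B.arm t ω = j} ≤ ∑ j ∈ Finset.univ.erase iStar, Δ j *
              (⌈c⌉₊ + c * Real.log m + c / 4 * (1 - b j m)) := by
          refine Finset.sum_le_sum fun j hj => ?_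
          have hj' := Finset.ne_of_mem_erase hj
          rw [← Finset.mul_sum, hinit j]
          refine mul_le_mul_of_nonneg_left ?_ (hΔ j hj')
          have h1 := mul_nonneg hc.le (Real.log_natCast_nonneg m)
          have h2 := mul_nonneg (by positivity : 0 ≤ c / 4) (sub_nonneg.2 (hb1 j hj' m))
          linarith
        have hDm : 0 ≤ D * (m - m * a m) :=
          mul_nonneg hD (sub_nonneg.2 (mul_le_of_le_one_right (by positivity) (ha1 m)))
        linarith
      | succ t ht ih =>
        have hsucc : B.pseudoRegret iStar (t + 1) = B.pseudoRegret iStar t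
            + ∑ j ∈ Finset.univ.erase iStar, Δ j * P.real {ω | B.arm (t + 1) ω = j} := by
          rw [B.pseudoRegret_eq, B.pseudoRegret_eq, Finset.sum_Icc_succ_top (by omega)]
        have hstep := hB.regret_step_le (x₀ := x₀) hc iStar hv hv1 hΔ hD hmeanD ht
        have ht0 : (0 : ℝ) < t := by exact_mod_cast hm1.trans ht
        have hlog : 1 / ((t : ℝ) + 1) ≤ Real.log ((t + 1 : ℕ) : ℝ) - Real.log t := by
          have h := Real.one_sub_inv_le_log_of_pos (x := ((t : ℝ) + 1) / t) (by positivity)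
          rw [Real.log_div (by positivity) (by positivity)] at h
          push_cast
          refine le_trans (le_of_eq ?_) h
          field_simp
          ring
        -- The drift multiplied by `t + 1` loses `2cδ² * a t ≥ 4 * a t`; one `a t` offsets the
        -- growth from `t` to `t + 1`, and another is the claim.
        have hastep : a t ≤ t * a t - ((t + 1 : ℕ) : ℝ) * a (t + 1) := by
          have h := hB.integral_weight_succ_le hc iStar measurableSet_Iic hδ hδ' hρ hstar ht
          change a (t + 1) + 2 * δ ^ 2 * (c / ((t : ℝ) + 1) * a t) ≤ a t at h
          have h' := mul_le_mul_of_nonneg_left h (by positivity : (0 : ℝ) ≤ (t : ℝ) + 1)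
          have h2 : ((t : ℝ) + 1) * (a (t + 1) + 2 * δ ^ 2 * (c / ((t : ℝ) + 1) * a t))
              = ((t : ℝ) + 1) * a (t + 1) + 2 * (c * δ ^ 2) * a t := by
            field_simp
          rw [h2] at h'
          have h3 := mul_le_mul_of_nonneg_right hδc (ha0 t)
          push_cast
          nlinarith [ha0 t]
        have hbstep : ∀ j, j ≠ iStar → ∫ ω, {ω | B.arm (t + 1) ω = j}.indicator
            (fun _ => (1 : ℝ)) ω * B.weight (1 - 2 * δ) (Set.Ioi x₀) j t ω ∂P
            ≤ c / 4 * (b j t - b j (t + 1)) := by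
          intro j hj
          have h := B.integral_weight_succ_add_le j (measurableSet_Ioi (a := x₀)) hδ hδ' hρ
            (hother j hj) t
          set I := ∫ ω, {ω | B.arm (t + 1) ω = j}.indicator
            (fun _ => (1 : ℝ)) ω * B.weight (1 - 2 * δ) (Set.Ioi x₀) j t ω ∂P with hI
          have hI0 : 0 ≤ I := integral_nonneg fun ω =>
            mul_nonneg (Set.indicator_nonneg (fun _ _ => zero_le_one) ω)
              (B.weight_nonneg j hv t ω)
          change b j (t + 1) + 2 * δ ^ 2 * I ≤ b j t at h
          have h2 : c / 4 * (2 * δ ^ 2 * I) ≤ c / 4 * (b j t - b j (t + 1)) :=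
            mul_le_mul_of_nonneg_left (by linarith) (by positivity)
          have h3 := mul_le_mul_of_nonneg_right hδc hI0
          linarith
        have hsum : ∑ j ∈ Finset.univ.erase iStar, Δ j * (c / ((t : ℝ) + 1) +
            ∫ ω, {ω | B.arm (t + 1) ω = j}.indicator (fun _ => (1 : ℝ)) ω *
              B.weight (1 - 2 * δ) (Set.Ioi x₀) j t ω ∂P)
            ≤ ∑ j ∈ Finset.univ.erase iStar, Δ j *
              (⌈c⌉₊ + c * Real.log ((t + 1 : ℕ) : ℝ) + c / 4 * (1 - b j (t + 1)))
              - ∑ j ∈ Finset.univ.erase iStar, Δ j *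
                (⌈c⌉₊ + c * Real.log t + c / 4 * (1 - b j t)) := by
          rw [← Finset.sum_sub_distrib]
          refine Finset.sum_le_sum fun j hj => ?_
          have hj' := Finset.ne_of_mem_erase hj
          rw [← mul_sub]
          refine mul_le_mul_of_nonneg_left ?_ (hΔ j hj')
          have h1 := mul_le_mul_of_nonneg_left hlog hc.le
          rw [mul_one_div] at h1
          linarith [hbstep j hj']
        have hDstep := mul_le_mul_of_nonneg_left hastep hD
        change _ ≤ _ + D * a t at hstep
        rw [hsucc]
        linarith
    refine (key T hTm).trans (add_le_add (Finset.sum_le_sum fun j hj => ?_) ?_)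
    · refine mul_le_mul_of_nonneg_left ?_ (hΔ j (Finset.ne_of_mem_erase hj))
      have := mul_nonneg (by positivity : 0 ≤ c / 4) (hb0 j T)
      linarith
    · refine mul_le_mul_of_nonneg_left ?_ hD
      have : 0 ≤ (T : ℝ) * a T := mul_nonneg (by positivity) (ha0 T)
      linarith

end

end AttackedBandit
end MedBandit

/-! ### The constants of the theorem. -/

theorem theorem3 {K : ℕ} (iStar : Fin K) (Δ : Fin K → ℝ) (c : ℝ) :
    ∃ M > (0 : ℝ), ∃ ζ > (0 : ℝ),
      ∀ (ν : Fin K → Measure ℝ) (ρ s x₀ : ℝ)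
        (Ω : Type*) [MeasurableSpace Ω] (P : Measure Ω) [IsProbabilityMeasure P]
        (B : AttackedBandit ν ρ P),
        (∀ i, IsProbabilityMeasure (ν i)) →
        (∀ i, Integrable (fun x : ℝ => x) (ν i)) →
        (∀ j, j ≠ iStar → mean (ν j) < mean (ν iStar)) →
        (∀ j, j ≠ iStar → Δ j = mean (ν iStar) - mean (ν j)) →
        0 < ρ → ρ < 1 → 0 < s → s < 1 →
        cdf (ν iStar) x₀ < 1 / 2 - s →
        (∀ j, j ≠ iStar → 1 / 2 + s < cdf (ν j) x₀) →
        ρ < s →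
        20 < c →
        (∀ j, j ≠ iStar → 2 / (cdf (ν j) x₀ - 1 / 2 - s) ^ 2 < c) →
        2 / (1 / 2 - s - cdf (ν iStar) x₀) ^ 2 < c →
        2 / (s - ρ) ^ 2 < c →
        B.IsMedEpsGreedy c →
        ((∀ i, 0 ≤ mean (ν i)) → ∀ T : ℕ, 1 ≤ T →
          B.pseudoRegret iStar T ≤
            c * (∑ j ∈ Finset.univ.erase iStar, Δ j) * Real.log T
              + 2 * c * (K : ℝ) * Real.exp 1 * mean (ν iStar)
              + ∑ j ∈ Finset.univ.erase iStar, (2 + 3 * c) * Δ j) ∧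
        (∀ T : ℕ, ζ ≤ (T : ℝ) → B.pseudoRegret iStar T ≤ M * Real.log T) := by
  -- `S` bounds every gap without reference to the means. Absolute values are needed because `c` and
  -- `Δ`, including `Δ iStar`, are still unconstrained.
  set S : ℝ := ∑ j, |Δ j| with hS
  have hS0 : 0 ≤ S := Finset.sum_nonneg fun j _ => abs_nonneg _
  set N : ℝ := S * (⌈c⌉₊ + |c| + |c| / 4) + S * (⌈c⌉₊ * K : ℕ) with hN
  have hN0 : 0 ≤ N := by positivity
  -- `N` may vanish, hence the `+ 1`; from `T ≥ 3 > e` on, `log T ≥ 1` absorbs the constant terms.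
  refine ⟨N + 1, by linarith, 3, by norm_num, ?_⟩
  intro ν ρ s x₀ Ω _ P _ B hprob _ hmean hΔ hρ hρ1 hs hs1 hstar hother hρs hc _ _ hcδ hB
  have hc0 : 0 < c := by linarith
  have hδ : 0 < s - ρ := by linarith
  have hδ' : s - ρ < 1 / 2 := by
    have := cdf_nonneg (ν iStar) x₀
    linarith
  have hδc : 2 ≤ c * (s - ρ) ^ 2 := ((div_lt_iff₀ (by positivity)).1 hcδ).le
  have hstar' : (ν iStar).real (Set.Iic x₀) + ρ ≤ 1 / 2 - (s - ρ) := by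
    rw [← cdf_eq_real]
    linarith
  have hother' : ∀ j, j ≠ iStar → (ν j).real (Set.Ioi x₀) + ρ ≤ 1 / 2 - (s - ρ) := by
    intro j hj
    rw [← Set.compl_Iic, probReal_compl_eq_one_sub measurableSet_Iic, ← cdf_eq_real]
    linarith [hother j hj]
  have hmain := fun (D : ℝ) hD hmD (T : ℕ) hT =>
    hB.pseudoRegret_le (D := D) (T := T) hc0 iStar (fun j hj => (hmean j hj).le) hD hmD hδ hδ' hδc
      hρ.le hstar' hother' hT
  have hsumΔ : ∑ j ∈ Finset.univ.erase iStar, (mean (ν iStar) - mean (ν j))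
      = ∑ j ∈ Finset.univ.erase iStar, Δ j :=
    Finset.sum_congr rfl fun j hj => (hΔ j (Finset.ne_of_mem_erase hj)).symm
  have hΔ0 : 0 ≤ ∑ j ∈ Finset.univ.erase iStar, Δ j := Finset.sum_nonneg fun j hj => by
    have hj' := Finset.ne_of_mem_erase hj
    linarith [hΔ j hj', hmean j hj']
  have hceil : (⌈c⌉₊ : ℝ) ≤ c + 1 := (Nat.ceil_lt_add_one hc0.le).le
  constructor
  · intro hnonneg T hT
    -- With non-negative means every gap is at most `μ*`, so `D = μ*` is allowed.
    have h := hmain (mean (ν iStar)) (hnonneg iStar) (fun j _ => by linarith [hnonneg j]) T hT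
    rw [← Finset.sum_mul, hsumΔ] at h
    rw [← Finset.mul_sum]
    have h1 : (∑ j ∈ Finset.univ.erase iStar, Δ j) * (⌈c⌉₊ + c / 4)
        ≤ (∑ j ∈ Finset.univ.erase iStar, Δ j) * (2 + 3 * c) :=
      mul_le_mul_of_nonneg_left (by linarith) hΔ0
    have h2 : mean (ν iStar) * (⌈c⌉₊ * K : ℕ) ≤ mean (ν iStar) * (2 * c * K * Real.exp 1) := by
      refine mul_le_mul_of_nonneg_left ?_ (hnonneg iStar)
      push_cast
      have he : 1 ≤ Real.exp 1 := Real.one_le_exp zero_le_one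
      calc (⌈c⌉₊ : ℝ) * K ≤ 2 * c * K := by gcongr; linarith
        _ ≤ 2 * c * K * Real.exp 1 := le_mul_of_one_le_right (by positivity) he
    linarith
  · intro T hT
    have hlog : 1 ≤ Real.log T := by
      rw [Real.le_log_iff_exp_le (by linarith)]
      linarith [Real.exp_one_lt_d9]
    have hΔS : ∑ j ∈ Finset.univ.erase iStar, Δ j ≤ S :=
      (Finset.sum_le_sum fun j _ => le_abs_self _).trans
        (Finset.sum_le_sum_of_subset_of_nonneg (Finset.erase_subset _ _) fun _ _ _ => abs_nonneg _)
    have hmD : ∀ j, j ≠ iStar → mean (ν iStar) - mean (ν j) ≤ S := by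
      intro j hj
      rw [← hΔ j hj]
      exact (le_abs_self _).trans
        (Finset.single_le_sum (f := fun j => |Δ j|) (fun i _ => abs_nonneg _) (Finset.mem_univ j))
    have hT1 : 1 ≤ T := by
      have : (1 : ℝ) ≤ T := by linarith
      exact_mod_cast this
    have h := hmain S hS0 hmD T hT1
    rw [← Finset.sum_mul, hsumΔ] at h
    have h1 : (∑ j ∈ Finset.univ.erase iStar, Δ j) * (⌈c⌉₊ + c * Real.log T + c / 4)
        ≤ S * (⌈c⌉₊ + c * Real.log T + c / 4) :=
      mul_le_mul_of_nonneg_right hΔS (by positivity)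
    have h2 : S * (⌈c⌉₊ + c * Real.log T + c / 4) ≤ S * ((⌈c⌉₊ + c + c / 4) * Real.log T) := by
      refine mul_le_mul_of_nonneg_left ?_ hS0
      have : ((⌈c⌉₊ : ℝ) + c / 4) * 1 ≤ (⌈c⌉₊ + c / 4) * Real.log T :=
        mul_le_mul_of_nonneg_left hlog (by positivity)
      linarith
    have h3 : S * ((⌈c⌉₊ * K : ℕ) : ℝ) * 1 ≤ S * ((⌈c⌉₊ * K : ℕ) : ℝ) * Real.log T :=
      mul_le_mul_of_nonneg_left hlog (by positivity)
    rw [hN, abs_of_pos hc0]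
    linarith
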